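/- Let $G$ be a connected, locally finite graph whose vertex set is $\mathbb{Z}^2\times F$ with $F$ finite, such that every translation $(x,f)\mapsto(a+x,f)$, $a\in\mathbb{Z}^2$, is an automorphism of $G$. Let every directed edge $uv$ of $G$ carry a weight $c(uv)\ge 0$, invariant under these translations (in general $c(uv)\neq c(vu)$), such that every vertex has an outgoing edge of positive weight. The random walk on $G$ is the Markov chain $(X_n)_{n\ge 0}$ with transition probabilities $\mathbb{P}(X_{n+1}=v\mid X_n=u)=c(uv)/\sum_{v'\sim u}c(uv')$. Suppose that the walk is irreducible (every vertex can be reached from every other one along directed edges of positive weight) and transient (started at any vertex, it returns there with probability less than one). Then $G$ satisfies condition $(\star)$, that is, the following holds. Let $(\Lambda_N)_N$ be any exhausting sequence of finite sets of vertices (every vertex lies in $\Lambda_N$ for all large $N$), and let $G_N$ be the graph obtained from $G$ by gluing all vertices outside $\Lambda_N$ into one boundary vertex $r$. For vertices $a,v$ let $g_N(a,v)$ be the expected number of visits to $v$, time $0$ included, of the random walk started at $a$ and killed when it hits $r$ (so $g_N(a,v)=0$ if $a$ or $v$ is not in $\Lambda_N$). Then all $g_N(a,v)$ are finite; for every directed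 edge $v_1v_2$ of $G$ and every vertex $v$ the limit $$B_{v_1v_2,\,v}=\lim_{N\to\infty}\bigl(g_N(v_2,v)-g_N(v_1,v)\bigr)$$ exists; and $B_{v_1v_2,\,v}\to 0$ as the graph distance between the edge $v_1v_2$ and the vertex $v$ tends to infinity, that is, for every $\varepsilon>0$ there is an $R$ such that $|B_{v_1v_2,\,v}|<\varepsilon$ for all directed edges $v_1v_2$ and all vertices $v$ at graph distance at least $R$ from $v_1$. -/

import Mathlib

open MeasureTheory ProbabilityTheory Filter Topology
open scoped ENNReal

noncomputable section

namespace PeriodicWalk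

/-- Vertices `(x, y; f)` of a graph periodic under `ℤ²`: a cell `(x, y)` of `ℤ²` together with
a vertex `f` of the finite quotient graph. -/
@[ext]
structure Vertex (F : Type*) where
  cell : ℤ × ℤ
  base : F

/-- Translation of a vertex by an element of `ℤ²`. -/
def shift {F : Type*} (a : ℤ × ℤ) (v : Vertex F) : Vertex F := ⟨a + v.cell, v.base⟩

instance {F : Type*} : MeasurableSpace (Vertex F) := ⊤

instance {F : Type*} : DiscreteMeasurableSpace (Vertex F) := ⟨fun _ => trivial⟩

instance {F : Type*} [Finite F] : Countable (Vertex F) :=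
  Function.Injective.countable (f := fun v : Vertex F => (v.cell, v.base)) (by
    intro u v h
    simp only [Prod.mk.injEq] at h
    exact Vertex.ext h.1 h.2)

/-- A connected, locally finite graph which is invariant under the translations of `ℤ²`, with an
invariant non-negative weight `c u v` on every directed edge `uv` (in general `c u v ≠ c v u`).
The total weight of the edges leaving a vertex is positive, so that the random walk makes sense.
The quotient graph is finite when `F` is. -/
structure WeightedGraph (F : Type*) where
  graph : SimpleGraph (Vertex F)
  connected : graph.Connected
  finite_neighborSet : ∀ u, (graph.neighborSet u).Finite
  adj_shift : ∀ a u v, graph.Adj (shift a u) (shift a v) ↔ graph.Adj u v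
  c : Vertex F → Vertex F → ℝ
  c_nonneg : ∀ u v, 0 ≤ c u v
  c_eq_zero : ∀ u v, ¬ graph.Adj u v → c u v = 0
  c_shift : ∀ a u v, c (shift a u) (shift a v) = c u v
  exists_c_pos : ∀ u, ∃ v, 0 < c u v

namespace WeightedGraph

variable {F : Type*} (G : WeightedGraph F)

/-- The finite set of neighbours of `u`. -/
def nbrs (u : Vertex F) : Finset (Vertex F) := (G.finite_neighborSet u).toFinset

lemma mem_nbrs {u v : Vertex F} : v ∈ G.nbrs u ↔ G.graph.Adj u v := by
  simp [nbrs]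

/-- The total weight of the edges leaving `u`. -/
def outWeight (u : Vertex F) : ℝ := ∑ v ∈ G.nbrs u, G.c u v

lemma outWeight_pos (u : Vertex F) : 0 < G.outWeight u := by
  obtain ⟨v, hv⟩ := G.exists_c_pos u
  have hmem : v ∈ G.nbrs u := by
    rw [mem_nbrs]
    by_contra h
    exact hv.ne' (G.c_eq_zero u v h)
  exact Finset.sum_pos' (fun w _ => G.c_nonneg u w) ⟨v, hmem, hv⟩

/-- The transition probability `p u v = c u v / ∑ v' ~ u, c u v'` of the random walk. -/
def p (u v : Vertex F) : ℝ := G.c u v / G.outWeight u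

/-- The law of one step of the random walk from `u`. -/
def step (u : Vertex F) : PMF (Vertex F) :=
  PMF.ofFinset (fun v => ENNReal.ofReal (G.p u v)) (G.nbrs u)
    (by
      simp only [p]
      rw [← ENNReal.ofReal_sum_of_nonneg
        (fun v _ => div_nonneg (G.c_nonneg u v) (G.outWeight_pos u).le)]
      rw [← Finset.sum_div]
      change ENNReal.ofReal (G.outWeight u / G.outWeight u) = 1
      rw [div_self (G.outWeight_pos u).ne', ENNReal.ofReal_one])
    (fun v hv => by
      rw [mem_nbrs] at hv
      simp [p, G.c_eq_zero u v hv])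

/-- The transition kernel at time `n`: given the path up to time `n`, make one step of the walk
from the current position. -/
def transition (n : ℕ) : Kernel ((i : Finset.Iic n) → Vertex F) (Vertex F) where
  toFun x := (G.step (x ⟨n, Finset.mem_Iic.2 le_rfl⟩)).toMeasure
  measurable' :=
    (Measurable.of_discrete (f := fun u : Vertex F => (G.step u).toMeasure)).comp
      (measurable_pi_apply _)

instance (n : ℕ) : IsMarkovKernel (G.transition n) :=
  ⟨fun _ => PMF.toMeasure.isProbabilityMeasure _⟩

/-- The law, on the space of trajectories `X₀, X₁, X₂, …`, of the random walk on the weighted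
graph started at `a`: the Markov chain with transition probabilities `p`. -/
def walk (a : Vertex F) : Measure (ℕ → Vertex F) :=
  Kernel.traj (X := fun _ => Vertex F) G.transition 0 (fun _ => a)

/-- The walk is irreducible: every vertex can be reached from every other one along directed
edges of positive weight. -/
def Irreducible : Prop :=
  ∀ u v : Vertex F, Relation.ReflTransGen (fun a b => 0 < G.c a b) u v

/-- The walk is transient: from each vertex, the probability of ever returning to it is less
than one. -/
def Transient : Prop :=
  ∀ v : Vertex F, G.walk v {X | ∃ n, 1 ≤ n ∧ X n = v} < 1

/-- The number of visits to `v` of the trajectory `X` killed at its first exit from `Λ`. -/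
def killedVisits (Λ : Finset (Vertex F)) (v : Vertex F) (X : ℕ → Vertex F) : ℕ∞ :=
  {n : ℕ | X n = v ∧ ∀ k ≤ n, X k ∈ Λ}.encard

/-- The expected number of visits to `v` of the walk started at `a` and killed when it leaves `Λ`,
that is, when it hits the boundary vertex obtained by gluing all vertices outside `Λ`. -/
def expectedVisits (Λ : Finset (Vertex F)) (a v : Vertex F) : ℝ≥0∞ :=
  ∫⁻ X, (killedVisits Λ v X : ℝ≥0∞) ∂(G.walk a)

/-- The expected difference between the numbers of visits to `v` of the walks killed outside `Λ`
which start at the two ends of the directed edge `v₁v₂`. -/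
def visitDiff (Λ : Finset (Vertex F)) (v₁ v₂ v : Vertex F) : ℝ :=
  (G.expectedVisits Λ v₂ v).toReal - (G.expectedVisits Λ v₁ v).toReal

/-- `Λ N` is the set of non-boundary vertices of the `N`-th graph of an exhausting sequence:
every vertex belongs to all `Λ N` with `N` large. -/
def IsExhaustion (Λ : ℕ → Finset (Vertex F)) : Prop :=
  ∀ v, ∀ᶠ N in atTop, v ∈ Λ N

/-- Condition (⋆): for every exhausting sequence, the expected numbers of visits of the killed
walks are finite, their differences along the edges converge as `N → ∞`, and the limit tends to
zero, uniformly, as the graph distance between the edge and the vertex tends to infinity. -/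
def ConditionStar : Prop :=
  ∀ Λ : ℕ → Finset (Vertex F), IsExhaustion Λ →
    (∀ N a v, G.expectedVisits (Λ N) a v ≠ ∞) ∧
    ∃ B : Vertex F → Vertex F → Vertex F → ℝ,
      (∀ v₁ v₂ v, G.graph.Adj v₁ v₂ →
        Tendsto (fun N => G.visitDiff (Λ N) v₁ v₂ v) atTop (𝓝 (B v₁ v₂ v))) ∧
      ∀ ε > 0, ∃ R : ℕ, ∀ v₁ v₂ v, G.graph.Adj v₁ v₂ → R ≤ G.graph.dist v₁ v →
        |B v₁ v₂ v| < ε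

end WeightedGraph

end PeriodicWalk

end

/-! By transience the Green function `green a v` is finite, and it is bounded by the inverse of the
escape probability of `v`, which periodicity makes uniform (`exists_green_le`). Dominated
convergence sends the killed visits to `green`, so `B` is the increment of `green · v` along the
edge.

Decay is a compactness argument. Translate the edge into a finite set; far poles then escape every
vertex. Since `green · v` is harmonic off `v`, its limits along an ultrafilter are bounded harmonic
functions, which are constant by the Liouville property (`IsHarmonic.eq_of_bounded`). That property
comes from extremal increments: a largest increment under a translation is constant by the maximum
principle, so a positive one would force linear growth. -/

namespace PeriodicWalk

namespace WeightedGraph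

/-! ### Path expectations and the Green function -/

section Walk

variable {F : Type*} (G : WeightedGraph F)

/-- The averaging operator of the walk: `avg ψ a` is the mean of `ψ` after one step from `a`. -/
noncomputable def avg (ψ : Vertex F → ℝ≥0∞) (a : Vertex F) : ℝ≥0∞ :=
  ∫⁻ b, ψ b ∂(G.step a).toMeasure

lemma avg_mono {ψ ψ' : Vertex F → ℝ≥0∞} (h : ∀ b, ψ b ≤ ψ' b) (a : Vertex F) :
    G.avg ψ a ≤ G.avg ψ' a :=
  lintegral_mono h

lemma avg_add (ψ ψ' : Vertex F → ℝ≥0∞) (a : Vertex F) :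
    G.avg (fun b => ψ b + ψ' b) a = G.avg ψ a + G.avg ψ' a :=
  lintegral_add_left .of_discrete _

lemma avg_const_mul (r : ℝ≥0∞) (ψ : Vertex F → ℝ≥0∞) (a : Vertex F) :
    G.avg (fun b => r * ψ b) a = r * G.avg ψ a :=
  lintegral_const_mul _ .of_discrete

lemma avg_one (a : Vertex F) : G.avg (fun _ => 1) a = 1 := by
  simp [avg]

lemma avg_tsum (ψ : ℕ → Vertex F → ℝ≥0∞) (a : Vertex F) :
    G.avg (fun b => ∑' n, ψ n b) a = ∑' n, G.avg (ψ n) a :=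
  lintegral_tsum fun _ => Measurable.of_discrete.aemeasurable

/-- The expectation of `∏ k < n, φ k (X k) * ψ (X n)`, computed by conditioning on the first
step. -/
noncomputable def pathSum : (ℕ → Vertex F → ℝ≥0∞) → ℕ → (Vertex F → ℝ≥0∞) → Vertex F → ℝ≥0∞
  | _, 0, ψ => ψ
  | φ, n + 1, ψ => fun a => φ 0 a * G.avg (pathSum (fun k => φ (k + 1)) n ψ) a

/-- Conditioning on the last step instead of the first one gives the same expectation. -/
lemma pathSum_succ (φ : ℕ → Vertex F → ℝ≥0∞) (n : ℕ) (ψ : Vertex F → ℝ≥0∞) :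
    G.pathSum φ (n + 1) ψ = G.pathSum φ n (fun b => φ n b * G.avg ψ b) := by
  induction n generalizing φ with
  | zero => rfl
  | succ n ih =>
    funext a
    rw [pathSum, ih]
    rfl

instance (a : Vertex F) : IsProbabilityMeasure (G.walk a) := by
  unfold walk; infer_instance

lemma lintegral_walk_zero (a : Vertex F) (ψ : Vertex F → ℝ≥0∞) :
    ∫⁻ X, ψ (X 0) ∂(G.walk a) = ψ a := by
  have hm : Measurable fun X : ℕ → Vertex F => ψ (X 0) :=
    (Measurable.of_discrete (f := ψ)).comp (measurable_pi_apply 0)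
  rw [walk, Kernel.lintegral_traj _ hm]
  simp [Function.updateFinset]

/-- The Markov property: the joint law of the path up to time `n` and of `X (n + 1)` is the law of
the path composed with `transition n`. -/
lemma lintegral_walk_succ (a : Vertex F) (n : ℕ) {φ : ((i : Finset.Iic n) → Vertex F) → ℝ≥0∞}
    (hφ : Measurable φ) (ψ : Vertex F → ℝ≥0∞) :
    ∫⁻ X, φ (Preorder.frestrictLe n X) * ψ (X (n + 1)) ∂(G.walk a) =
      ∫⁻ X, φ (Preorder.frestrictLe n X) * G.avg ψ (X n) ∂(G.walk a) := by
  have hψ : Measurable ψ := .of_discrete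
  have hf : Measurable fun q : ((i : Finset.Iic n) → Vertex F) × Vertex F => φ q.1 * ψ q.2 :=
    (hφ.comp measurable_fst).mul (hψ.comp measurable_snd)
  have hmap := Kernel.partialTraj_compProd_eq_map_traj (X := fun _ => Vertex F)
    (κ := G.transition) (Nat.zero_le n) (x₀ := fun _ => a)
  have hQ : Measurable fun x : (i : Finset.Iic n) → Vertex F =>
      φ x * G.avg ψ (x ⟨n, Finset.mem_Iic.2 le_rfl⟩) :=
    hφ.mul ((Measurable.of_discrete (f := G.avg ψ)).comp (measurable_pi_apply _))
  calc ∫⁻ X, φ (Preorder.frestrictLe n X) * ψ (X (n + 1)) ∂(G.walk a)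
      = ∫⁻ q, φ q.1 * ψ q.2 ∂((G.walk a).map
          fun X => (Preorder.frestrictLe n X, X (n + 1))) := by
        rw [lintegral_map hf (by fun_prop)]
    _ = ∫⁻ x, ∫⁻ b, φ x * ψ b ∂(G.transition n x)
          ∂(Kernel.partialTraj (X := fun _ => Vertex F) G.transition 0 n fun _ => a) := by
        rw [walk, ← hmap, Measure.lintegral_compProd hf]
    _ = ∫⁻ x, φ x * G.avg ψ (x ⟨n, Finset.mem_Iic.2 le_rfl⟩)
          ∂(Kernel.partialTraj (X := fun _ => Vertex F) G.transition 0 n fun _ => a) := by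
        refine lintegral_congr fun x => ?_
        rw [lintegral_const_mul _ hψ]
        rfl
    _ = _ := by
        rw [← Kernel.traj_map_frestrictLe_apply, lintegral_map hQ (by fun_prop)]
        rfl

lemma lintegral_walk_prod (a : Vertex F) (φ : ℕ → Vertex F → ℝ≥0∞) (n : ℕ)
    (ψ : Vertex F → ℝ≥0∞) :
    ∫⁻ X, (∏ k ∈ Finset.range n, φ k (X k)) * ψ (X n) ∂(G.walk a) = G.pathSum φ n ψ a := by
  induction n generalizing ψ with
  | zero => simpa [pathSum] using G.lintegral_walk_zero a ψ
  | succ n ih =>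
    rw [pathSum_succ, ← ih]
    have hφ : Measurable fun x : (i : Finset.Iic n) → Vertex F => ∏ k : Finset.Iic n, φ k (x k) :=
      Finset.measurable_prod _ fun k _ =>
        (Measurable.of_discrete (f := φ k)).comp (measurable_pi_apply k)
    have hprod (X : ℕ → Vertex F) :
        ∏ k ∈ Finset.range (n + 1), φ k (X k) =
          ∏ k : Finset.Iic n, φ k (Preorder.frestrictLe n X k) := by
      rw [show Finset.range (n + 1) = Finset.Iic n by ext; simp]
      exact (Finset.prod_coe_sort (Finset.Iic n) fun k => φ k (X k)).symm
    simp only [hprod]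
    rw [G.lintegral_walk_succ a n hφ ψ]
    simp only [← hprod, Finset.prod_range_succ, mul_assoc]

lemma measurableSet_eval (s : Set (Vertex F)) (n : ℕ) :
    MeasurableSet {X : ℕ → Vertex F | X n ∈ s} :=
  measurable_pi_apply n (MeasurableSet.of_discrete (s := s))

lemma measurable_indicator_eval (s : Set (Vertex F)) (n : ℕ) :
    Measurable fun X : ℕ → Vertex F => s.indicator (1 : Vertex F → ℝ≥0∞) (X n) :=
  (Measurable.of_discrete (f := s.indicator (1 : Vertex F → ℝ≥0∞))).comp (measurable_pi_apply n)

/-- The Green function: the expected number of visits to `v` of the walk started at `a`. -/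
noncomputable def green (a v : Vertex F) : ℝ≥0∞ :=
  ∑' n, G.pathSum 1 n (({v} : Set (Vertex F)).indicator 1) a

lemma green_eq (a v : Vertex F) :
    G.green a v = ({v} : Set (Vertex F)).indicator 1 a + G.avg (fun b => G.green b v) a := by
  unfold green
  rw [tsum_eq_zero_add' ENNReal.summable, avg_tsum]
  simp only [pathSum, Pi.one_apply, one_mul]
  rfl

lemma encard_visits (v : Vertex F) (X : ℕ → Vertex F) :
    (({n : ℕ | X n = v}.encard : ℕ∞) : ℝ≥0∞) =
      ∑' n, ({v} : Set (Vertex F)).indicator (1 : Vertex F → ℝ≥0∞) (X n) := by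
  rw [← ENNReal.tsum_set_one, tsum_subtype {n : ℕ | X n = v} fun _ => (1 : ℝ≥0∞)]
  rfl

lemma lintegral_visits (a v : Vertex F) :
    ∫⁻ X, (({n : ℕ | X n = v}.encard : ℕ∞) : ℝ≥0∞) ∂(G.walk a) = G.green a v := by
  simp only [encard_visits]
  rw [lintegral_tsum fun n => (measurable_indicator_eval _ n).aemeasurable]
  refine tsum_congr fun n => ?_
  rw [← lintegral_walk_prod]
  simp

variable [Finite F]

lemma avg_eq_tsum (ψ : Vertex F → ℝ≥0∞) (a : Vertex F) :
    G.avg ψ a = ∑' b, ψ b * G.step a b := by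
  simp only [avg, lintegral_countable', PMF.toMeasure_apply_singleton _ _ (measurableSet_singleton _)]

end Walk

/-! ### Finiteness, approximation and periodicity of the Green function -/

section Green

variable {F : Type*} (G : WeightedGraph F)

/-- If the walk started at `v` returns to `v` with probability less than one, this bounds from
below the probability of avoiding `v` at the times `1, …, n + 1`. -/
lemma one_sub_return_le (v : Vertex F) (n : ℕ) :
    1 - G.walk v {X | ∃ n, 1 ≤ n ∧ X n = v} ≤
      G.avg (G.pathSum (fun _ => ({v} : Set (Vertex F))ᶜ.indicator 1) n
        (({v} : Set (Vertex F))ᶜ.indicator 1)) v := by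
  set χ : Vertex F → ℝ≥0∞ := ({v} : Set (Vertex F))ᶜ.indicator 1 with hχ
  have hmeas : MeasurableSet {X : ℕ → Vertex F | ∃ n, 1 ≤ n ∧ X n = v} := by
    simp only [Set.ofPred_exists, Set.ofPred_and]
    exact .iUnion fun n => (MeasurableSet.const _).inter (measurableSet_eval {v} n)
  -- The factor at time 0 is 1 because the walk starts at `v` itself.
  have h := G.lintegral_walk_prod v (fun k => if k = 0 then 1 else χ) (n + 1) χ
  simp only [pathSum, if_pos, Pi.one_apply, one_mul, Nat.add_eq_zero_iff, one_ne_zero, and_false,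
    if_false] at h
  rw [← h, ← prob_compl_eq_one_sub hmeas, ← lintegral_indicator_one hmeas.compl]
  refine lintegral_mono fun X => ?_
  by_cases hX : X ∈ {X : ℕ → Vertex F | ∃ n, 1 ≤ n ∧ X n = v}ᶜ
  · have hne (k : ℕ) (hk : 1 ≤ k) : χ (X k) = 1 := by
      have : X k ≠ v := fun hkv => hX ⟨k, hk, hkv⟩
      simp [hχ, this]
    rw [Set.indicator_of_mem hX, hne _ (by omega), Finset.prod_eq_one]
    · simp
    · intro k _
      split_ifs with hk
      · rfl
      · exact hne k (by omega)
  · rw [Set.indicator_of_notMem hX]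
    exact zero_le

/-- Last-visit decomposition: after a visit at time `k`, the walk avoids `v` from then on with
probability at least `δ`. The events "last visit up to `n` at time `k`" and "no visit up to `n`" are
disjoint, whence `key`, proved by conditioning on the first step. -/
lemma return_mul_green_le (a v : Vertex F) :
    (1 - G.walk v {X | ∃ n, 1 ≤ n ∧ X n = v}) * G.green a v ≤ 1 := by
  set δ := 1 - G.walk v {X | ∃ n, 1 ≤ n ∧ X n = v} with hδ
  set χ : Vertex F → ℝ≥0∞ := ({v} : Set (Vertex F))ᶜ.indicator 1 with hχ
  set P : ℕ → Vertex F → ℝ≥0∞ := fun k => G.pathSum 1 k (({v} : Set (Vertex F)).indicator 1)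
    with hP
  have hPs (k : ℕ) : P (k + 1) = G.avg (P k) := by
    funext b
    simp only [hP, pathSum, Pi.one_apply, one_mul]
    rfl
  have key (n : ℕ) : ∀ a, G.pathSum (fun _ => χ) n χ a + δ * ∑ k ∈ Finset.range (n + 1), P k a
      ≤ 1 := by
    induction n with
    | zero =>
      intro a
      by_cases ha : a = v <;> simp [pathSum, hP, hχ, ha, hδ]
    | succ n ih =>
      intro a
      have h1 : G.avg (G.pathSum (fun _ => χ) n χ) a
          + δ * G.avg (fun b => ∑ k ∈ Finset.range (n + 1), P k b) a ≤ 1 := by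
        rw [← avg_const_mul, ← avg_add, ← G.avg_one a]
        exact G.avg_mono ih a
      have h2 : G.avg (fun b => ∑ k ∈ Finset.range (n + 1), P k b) a
          = ∑ k ∈ Finset.range (n + 1), P (k + 1) a := by
        simp only [hPs]
        exact lintegral_finsetSum _ fun _ _ => .of_discrete
      -- Only one term on the left survives: the second if `a = v`, the first otherwise.
      have h3 : χ a * G.avg (G.pathSum (fun _ => χ) n χ) a + δ * P 0 a ≤
          G.avg (G.pathSum (fun _ => χ) n χ) a := by
        by_cases ha : a = v
        · subst ha
          simpa [pathSum, hP, hχ, -tsub_le_iff_right] using G.one_sub_return_le a n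
        · simp [pathSum, hP, hχ, ha]
      rw [Finset.sum_range_succ', ← h2, mul_add, add_comm (δ * _), ← add_assoc]
      exact (add_le_add_left h3 _).trans h1
  rw [green, ENNReal.tsum_eq_iSup_nat, ENNReal.mul_iSup]
  refine iSup_le fun n => le_trans ?_ ((le_add_self).trans (key n a))
  gcongr
  exact Nat.le_succ n

lemma green_le_inv (a v : Vertex F) :
    G.green a v ≤ (1 - G.walk v {X | ∃ n, 1 ≤ n ∧ X n = v})⁻¹ := by
  rw [ENNReal.le_inv_iff_mul_le, mul_comm]
  exact G.return_mul_green_le a v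

lemma green_ne_top (htrans : G.Transient) (a v : Vertex F) : G.green a v ≠ ∞ := by
  refine ((G.green_le_inv a v).trans_lt ?_).ne
  rw [ENNReal.inv_lt_top]
  exact tsub_pos_of_lt (htrans v)

/-! ### Killed walks -/

lemma measurable_killedVisits (Λ : Finset (Vertex F)) (v : Vertex F) :
    Measurable fun X => (killedVisits Λ v X : ℝ≥0∞) := by
  have h (X : ℕ → Vertex F) : (killedVisits Λ v X : ℝ≥0∞) =
      ∑' n, {X : ℕ → Vertex F | X n = v ∧ ∀ k ≤ n, X k ∈ Λ}.indicator 1 X := by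
    rw [killedVisits, ← ENNReal.tsum_set_one,
      tsum_subtype {n : ℕ | X n = v ∧ ∀ k ≤ n, X k ∈ Λ} fun _ => (1 : ℝ≥0∞)]
    rfl
  simp only [h]
  refine Measurable.tsum fun n => measurable_one.indicator ?_
  simp only [Set.ofPred_and, Set.ofPred_forall]
  exact (measurableSet_eval {v} n).inter
    (.iInter fun k => .iInter fun _ => measurableSet_eval (Λ : Set (Vertex F)) k)

lemma killedVisits_le (Λ : Finset (Vertex F)) (v : Vertex F) (X : ℕ → Vertex F) :
    (killedVisits Λ v X : ℝ≥0∞) ≤ ({n : ℕ | X n = v}.encard : ℕ∞) := by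
  rw [ENat.toENNReal_le]
  exact Set.encard_le_encard fun n hn => hn.1

lemma expectedVisits_le_green (Λ : Finset (Vertex F)) (a v : Vertex F) :
    G.expectedVisits Λ a v ≤ G.green a v := by
  rw [← lintegral_visits]
  exact lintegral_mono (killedVisits_le Λ v)

/-- Almost surely the visits to `v` are finite in number, so the path up to the last one eventually
lies in `Λ N` and the two counts agree. The sets need not be nested, hence dominated rather than
monotone convergence. -/
lemma tendsto_expectedVisits {Λ : ℕ → Finset (Vertex F)} (hΛ : IsExhaustion Λ) (a v : Vertex F)
    (hfin : G.green a v ≠ ∞) :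
    Tendsto (fun N => G.expectedVisits (Λ N) a v) atTop (𝓝 (G.green a v)) := by
  have hvis : Measurable fun X : ℕ → Vertex F => (({n : ℕ | X n = v}.encard : ℕ∞) : ℝ≥0∞) := by
    simp only [encard_visits]
    exact Measurable.tsum fun n => measurable_indicator_eval _ n
  rw [← lintegral_visits] at hfin ⊢
  refine tendsto_lintegral_of_dominated_convergence _
    (fun N => measurable_killedVisits (Λ N) v)
    (fun N => Eventually.of_forall (killedVisits_le (Λ N) v)) hfin ?_
  filter_upwards [ae_lt_top hvis hfin] with X hX
  have hS : {n : ℕ | X n = v}.Finite := by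
    rw [← Set.encard_lt_top_iff]
    exact ENat.toENNReal_lt_top.1 hX
  refine tendsto_const_nhds.congr' ?_
  have hev : ∀ᶠ N in atTop, ∀ n ∈ {n : ℕ | X n = v}, ∀ k ∈ Set.Iic n, X k ∈ Λ N :=
    (eventually_all_finite hS).2 fun n _ => (eventually_all_finite (Set.finite_Iic n)).2
      fun k _ => hΛ (X k)
  filter_upwards [hev] with N hN
  rw [killedVisits]
  congr 3
  ext n
  exact ⟨fun hn => ⟨hn, hN n hn⟩, fun hn => hn.1⟩

/-! ### Periodicity -/

lemma shift_zero (v : Vertex F) : shift 0 v = v := by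
  simp [shift]

lemma shift_add (s t : ℤ × ℤ) (v : Vertex F) : shift (s + t) v = shift s (shift t v) := by
  simp [shift, add_assoc]

lemma shift_injective (t : ℤ × ℤ) : Function.Injective (shift (F := F) t) := by
  intro u v h
  simp only [shift, Vertex.mk.injEq, add_right_inj] at h
  exact Vertex.ext h.1 h.2

/-- Translation by `t` as a permutation of the vertices. -/
def shiftEquiv (t : ℤ × ℤ) : Vertex F ≃ Vertex F where
  toFun := shift t
  invFun := shift (-t)
  left_inv v := by rw [← shift_add, neg_add_cancel, shift_zero]
  right_inv v := by rw [← shift_add, add_neg_cancel, shift_zero]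

lemma sum_nbrs_shift {M : Type*} [AddCommMonoid M] (t : ℤ × ℤ) (u : Vertex F)
    (f : Vertex F → M) :
    ∑ b ∈ G.nbrs (shift t u), f b = ∑ b ∈ G.nbrs u, f (shift t b) :=
  (Finset.sum_equiv (shiftEquiv t)
    (fun b => by
      simp only [mem_nbrs]
      exact (G.adj_shift t u b).symm) fun _ _ => rfl).symm

lemma p_shift (t : ℤ × ℤ) (u v : Vertex F) : G.p (shift t u) (shift t v) = G.p u v := by
  simp only [p, outWeight, sum_nbrs_shift, c_shift]

lemma dist_shift_le (t : ℤ × ℤ) (u v : Vertex F) :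
    G.graph.dist (shift t u) (shift t v) ≤ G.graph.dist u v := by
  obtain ⟨w, hw⟩ := G.connected.exists_walk_length_eq_dist u v
  let φ : G.graph →g G.graph := ⟨shift t, fun h => (G.adj_shift t _ _).2 h⟩
  rw [← hw, ← w.length_map φ]
  exact SimpleGraph.dist_le _

lemma dist_shift (t : ℤ × ℤ) (u v : Vertex F) :
    G.graph.dist (shift t u) (shift t v) = G.graph.dist u v := by
  refine le_antisymm (G.dist_shift_le t u v) ?_
  simpa only [← shift_add, neg_add_cancel, shift_zero] using
    G.dist_shift_le (-t) (shift t u) (shift t v)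

lemma p_nonneg (u v : Vertex F) : 0 ≤ G.p u v :=
  div_nonneg (G.c_nonneg u v) (G.outWeight_pos u).le

lemma sum_p (u : Vertex F) : ∑ b ∈ G.nbrs u, G.p u b = 1 := by
  simp only [p, ← Finset.sum_div]
  exact div_self (G.outWeight_pos u).ne'

variable [Finite F]

lemma avg_eq_sum (ψ : Vertex F → ℝ≥0∞) (a : Vertex F) :
    G.avg ψ a = ∑ b ∈ G.nbrs a, ENNReal.ofReal (G.p a b) * ψ b := by
  rw [avg_eq_tsum, tsum_eq_sum (s := G.nbrs a)]
  · exact Finset.sum_congr rfl fun b _ => mul_comm _ _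
  · intro b hb
    rw [step, PMF.ofFinset_apply_of_notMem _ _ hb, mul_zero]

lemma avg_shift (t : ℤ × ℤ) (ψ : Vertex F → ℝ≥0∞) (a : Vertex F) :
    G.avg ψ (shift t a) = G.avg (fun b => ψ (shift t b)) a := by
  simp only [avg_eq_sum, sum_nbrs_shift, p_shift]

lemma pathSum_one_shift (t : ℤ × ℤ) (n : ℕ) (ψ : Vertex F → ℝ≥0∞) (a : Vertex F) :
    G.pathSum 1 n ψ (shift t a) = G.pathSum 1 n (fun b => ψ (shift t b)) a := by
  induction n generalizing a with
  | zero => rfl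
  | succ n ih =>
    simp only [pathSum, Pi.one_apply, one_mul, avg_shift]
    exact congrArg (G.avg · a) (funext ih)

lemma green_shift (t : ℤ × ℤ) (a v : Vertex F) :
    G.green (shift t a) (shift t v) = G.green a v := by
  have h : (fun b => ({shift t v} : Set (Vertex F)).indicator (1 : Vertex F → ℝ≥0∞) (shift t b)) =
      ({v} : Set (Vertex F)).indicator 1 := by
    funext b
    by_cases hb : b = v <;> simp [hb, (shift_injective t).eq_iff]
  simp only [green, pathSum_one_shift, h]

lemma exists_green_le (htrans : G.Transient) : ∃ C : ℝ, ∀ a v, (G.green a v).toReal ≤ C := by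
  cases nonempty_fintype F
  set δ : F → ℝ≥0∞ := fun f => (1 - G.walk ⟨0, f⟩ {X | ∃ n, 1 ≤ n ∧ X n = ⟨0, f⟩})⁻¹ with hδ
  have hfin (f : F) : δ f ≠ ∞ :=
    ENNReal.inv_ne_top.2 (tsub_pos_of_lt (htrans _)).ne'
  refine ⟨∑ f, (δ f).toReal, fun a v => ?_⟩
  have hv : v = shift v.cell ⟨0, v.base⟩ := by simp [shift]
  have ha : a = shift v.cell (shift (-v.cell) a) := by
    rw [← shift_add, add_neg_cancel, shift_zero]
  calc (G.green a v).toReal = (G.green (shift (-v.cell) a) ⟨0, v.base⟩).toReal := by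
        conv_lhs => rw [hv, ha, green_shift]
    _ ≤ (δ v.base).toReal := ENNReal.toReal_mono (hfin _) (G.green_le_inv _ _)
    _ ≤ _ := Finset.single_le_sum (f := fun f => (δ f).toReal)
        (fun _ _ => ENNReal.toReal_nonneg) (Finset.mem_univ _)

lemma toReal_green_eq (htrans : G.Transient) {a v : Vertex F} (hav : a ≠ v) :
    (G.green a v).toReal = ∑ b ∈ G.nbrs a, G.p a b * (G.green b v).toReal := by
  rw [green_eq, avg_eq_sum, Set.indicator_of_notMem (by simpa using hav), zero_add,
    ENNReal.toReal_sum fun b _ => ENNReal.mul_ne_top ENNReal.ofReal_ne_top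
      (G.green_ne_top htrans b v)]
  simp [ENNReal.toReal_mul, p_nonneg]

end Green

/-! ### Bounded harmonic functions -/

section Liouville

variable {F : Type*} (G : WeightedGraph F)

/-- A function on the vertices whose value at each vertex is its mean after one step. -/
def IsHarmonic (h : Vertex F → ℝ) : Prop :=
  ∀ a, h a = ∑ b ∈ G.nbrs a, G.p a b * h b

variable {G}

lemma IsHarmonic.comp_shift {h : Vertex F → ℝ} (hh : G.IsHarmonic h) (t : ℤ × ℤ) :
    G.IsHarmonic fun a => h (shift t a) := fun a => by
  simp only [hh (shift t a), sum_nbrs_shift, p_shift]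

lemma IsHarmonic.sub {h h' : Vertex F → ℝ} (hh : G.IsHarmonic h) (hh' : G.IsHarmonic h') :
    G.IsHarmonic fun a => h a - h' a := fun a => by
  simp only [mul_sub, Finset.sum_sub_distrib, ← hh a, ← hh' a]

/-- The maximum principle. -/
lemma IsHarmonic.eq_of_le {h : Vertex F → ℝ} (hh : G.IsHarmonic h) (hirr : G.Irreducible)
    {M : ℝ} (hle : ∀ a, h a ≤ M) {a : Vertex F} (ha : h a = M) (b : Vertex F) : h b = M := by
  induction hirr a b with
  | refl => exact ha
  | @tail b d _ hbd ih =>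
    have hadj : d ∈ G.nbrs b := by
      rw [mem_nbrs]
      by_contra hn
      exact hbd.ne' (G.c_eq_zero b d hn)
    have hsum : ∑ e ∈ G.nbrs b, G.p b e * (M - h e) = 0 := by
      simp only [mul_sub, Finset.sum_sub_distrib, ← hh b, ← Finset.sum_mul, sum_p, ih]
      ring
    have h0 := (Finset.sum_eq_zero_iff_of_nonneg fun e _ =>
      mul_nonneg (G.p_nonneg b e) (sub_nonneg.2 (hle e))).1 hsum d hadj
    have hp : 0 < G.p b d := div_pos hbd (G.outWeight_pos b)
    linarith [(mul_eq_zero.1 h0).resolve_left hp.ne']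

variable (G) in
/-- The harmonic functions with values in `[-C, C]` form a compact set for pointwise convergence. -/
lemma isCompact_harmonic (C : ℝ) :
    IsCompact {h : Vertex F → ℝ | G.IsHarmonic h ∧ ∀ a, h a ∈ Set.Icc (-C) C} := by
  have hK : IsCompact (Set.univ.pi fun _ : Vertex F => Set.Icc (-C) C) :=
    isCompact_univ_pi fun _ => isCompact_Icc
  have hcl : IsClosed {h : Vertex F → ℝ | G.IsHarmonic h} := by
    simp only [IsHarmonic, Set.ofPred_forall]
    exact isClosed_iInter fun a => isClosed_eq (by fun_prop) (by fun_prop)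
  convert! hK.inter_left hcl using 1
  ext h
  simp only [Set.mem_ofPred_eq, Set.mem_inter_iff, Set.mem_univ_pi]

/-- The supremum `M` of all increments under `t`, over `K` and all vertices, is attained: `K` is
compact and translation invariant, so only the finitely many vertices of cell 0 matter. -/
lemma IsHarmonic.shift_le [Finite F] {h : Vertex F → ℝ} (hh : G.IsHarmonic h)
    (hirr : G.Irreducible) {C : ℝ} (hC : ∀ a, h a ∈ Set.Icc (-C) C) (t : ℤ × ℤ) (a : Vertex F) :
    h (shift t a) ≤ h a := by
  set K := {h : Vertex F → ℝ | G.IsHarmonic h ∧ ∀ a, h a ∈ Set.Icc (-C) C} with hK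
  have hmax (f : F) : ∃ k ∈ K, ∀ k' ∈ K,
      k' (shift t ⟨0, f⟩) - k' ⟨0, f⟩ ≤ k (shift t ⟨0, f⟩) - k ⟨0, f⟩ :=
    (G.isCompact_harmonic C).exists_isMaxOn ⟨h, hh, hC⟩
      (f := fun k => k (shift t ⟨0, f⟩) - k ⟨0, f⟩) (by fun_prop)
  choose k hkK hk using hmax
  have : Nonempty F := ⟨a.base⟩
  obtain ⟨f₀, hf₀⟩ := Finite.exists_max fun f => k f (shift t ⟨0, f⟩) - k f ⟨0, f⟩
  set M := k f₀ (shift t ⟨0, f₀⟩) - k f₀ ⟨0, f₀⟩ with hM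
  have hle (k' : Vertex F → ℝ) (hk' : k' ∈ K) (b : Vertex F) : k' (shift t b) - k' b ≤ M := by
    have h1 := (hk b.base (fun d => k' (shift b.cell d))
      ⟨hk'.1.comp_shift _, fun d => hk'.2 _⟩).trans (hf₀ b.base)
    have hb : shift b.cell ⟨0, b.base⟩ = b := by simp [shift]
    simpa only [← shift_add, add_comm b.cell t, shift_add t b.cell, hb] using h1
  have hconst := (((hkK f₀).1.comp_shift t).sub (hkK f₀).1).eq_of_le hirr
    (hle _ (hkK f₀)) hM.symm
  -- The increment of the maximiser is harmonic and attains its maximum `M`, so it is `M`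
  -- everywhere.
  have hn (n : ℕ) : k f₀ (shift (n • t) a) = k f₀ a + n * M := by
    induction n with
    | zero => simp [shift_zero]
    | succ n ih =>
      have := hconst (shift (n • t) a)
      rw [succ_nsmul', shift_add]
      push_cast
      linarith
  have hM0 : M ≤ 0 := by
    by_contra! hpos
    obtain ⟨n, hn'⟩ := exists_nat_gt (2 * C / M)
    rw [div_lt_iff₀ hpos] at hn'
    have h1 := ((hkK f₀).2 (shift (n • t) a)).2
    have h2 := ((hkK f₀).2 a).1
    linarith [hn n]
  linarith [hle h ⟨hh, hC⟩ a]

/-- The Liouville property: bounded harmonic functions are constant. -/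
lemma IsHarmonic.eq_of_bounded [Finite F] {h : Vertex F → ℝ} (hh : G.IsHarmonic h)
    (hirr : G.Irreducible) {C : ℝ} (hC : ∀ a, h a ∈ Set.Icc (-C) C) (a b : Vertex F) :
    h a = h b := by
  have hper (t : ℤ × ℤ) (d : Vertex F) : h (shift t d) = h d := by
    refine le_antisymm (hh.shift_le hirr hC t d) ?_
    simpa only [← shift_add, neg_add_cancel, shift_zero] using
      hh.shift_le hirr hC (-t) (shift t d)
  have hbase (d : Vertex F) : h d = h ⟨0, d.base⟩ := by
    simpa [shift] using hper d.cell ⟨0, d.base⟩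
  have : Nonempty F := ⟨a.base⟩
  -- A periodic function takes finitely many values, so it attains its maximum.
  obtain ⟨f₀, hf₀⟩ := Finite.exists_max fun f : F => h ⟨0, f⟩
  have hconst := hh.eq_of_le hirr (fun d => (hbase d).trans_le (hf₀ d.base)) rfl
  rw [hconst a, hconst b]

end Liouville

/-! ### Decay of the increments -/

section Decay

variable {F : Type*} [Finite F] (G : WeightedGraph F)

/-- Along any ultrafilter on which `v i` leaves every vertex, the increments of the Green function
with pole `v i` tend to zero. -/
lemma tendsto_green_sub {ι : Type*} (U : Ultrafilter ι) {v : ι → Vertex F}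
    (hv : ∀ a, ∀ᶠ i in U, a ≠ v i) (hirr : G.Irreducible) (htrans : G.Transient)
    (a b : Vertex F) :
    Tendsto (fun i => (G.green a (v i)).toReal - (G.green b (v i)).toReal) U (𝓝 0) := by
  obtain ⟨C, hC⟩ := G.exists_green_le htrans
  have hlim (a : Vertex F) : ∃ x ∈ Set.Icc (-C) C,
      Tendsto (fun i => (G.green a (v i)).toReal) U (𝓝 x) := by
    refine (isCompact_Icc.ultrafilter_le_nhds
      (U.map fun i => (G.green a (v i)).toReal) ?_)
    rw [le_principal_iff]
    refine mem_map.2 (Eventually.of_forall fun i => ⟨?_, hC _ _⟩)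
    exact (neg_nonpos.2 (ENNReal.toReal_nonneg.trans (hC a (v i)))).trans ENNReal.toReal_nonneg
  choose h hhC hh using hlim
  -- The mean value equation at `a` fails only for the pole at `a`, which the ultrafilter discards.
  have hharm : G.IsHarmonic h := fun a => by
    refine tendsto_nhds_unique (hh a) ?_
    refine (tendsto_finsetSum (G.nbrs a) fun b _ => (hh b).const_mul (G.p a b)).congr' ?_
    filter_upwards [hv a] with i hi
    exact (G.toReal_green_eq htrans hi).symm
  simpa [hharm.eq_of_bounded hirr hhC a b] using (hh a).sub (hh b)

/-- Given a counterexample for each `R`, translate its edge to start in cell 0. The set `T` of such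
edges is finite, so the edge is constant along an ultrafilter while the pole escapes. -/
lemma exists_green_sub_lt (hirr : G.Irreducible) (htrans : G.Transient) {ε : ℝ} (hε : 0 < ε) :
    ∃ R : ℕ, ∀ v₁ v₂ v, G.graph.Adj v₁ v₂ → R ≤ G.graph.dist v₁ v →
      |(G.green v₂ v).toReal - (G.green v₁ v).toReal| < ε := by
  by_contra! hcon
  choose v₁ v₂ v hadj hdist hge using hcon
  let T : Set (Vertex F × Vertex F) :=
    ⋃ f : F, (fun b => (⟨0, f⟩, b)) '' (G.nbrs ⟨0, f⟩ : Set (Vertex F))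
  have hT : T.Finite := Set.finite_iUnion fun f => (Finset.finite_toSet _).image _
  let s : ℕ → ℤ × ℤ := fun R => -(v₁ R).cell
  have hmem (R : ℕ) : (shift (s R) (v₁ R), shift (s R) (v₂ R)) ∈ T := by
    refine Set.mem_iUnion.2 ⟨(v₁ R).base, shift (s R) (v₂ R), ?_, ?_⟩
    · have := (G.adj_shift (s R) _ _).2 (hadj R)
      simpa [mem_nbrs, s, shift] using this
    · simp [s, shift]
  let U : Ultrafilter ℕ := hyperfilter ℕ
  have hU : (U : Filter ℕ) ≤ atTop := Nat.hyperfilter_le_atTop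
  obtain ⟨⟨a₁, a₂⟩, -, ha⟩ := (Ultrafilter.eventually_exists_mem_iff hT
    (P := fun q R => (shift (s R) (v₁ R), shift (s R) (v₂ R)) = q) (f := U)).1
    (Eventually.of_forall fun R => ⟨_, hmem R, rfl⟩)
  simp only [Prod.mk.injEq] at ha
  have hleave (a : Vertex F) : ∀ᶠ R in U, a ≠ shift (s R) (v R) := by
    filter_upwards [hU (eventually_gt_atTop (G.graph.dist a₁ a)), ha] with R hR haR heq
    have := hdist R
    rw [← G.dist_shift (s R), haR.1, ← heq] at this
    omega
  have hlim := G.tendsto_green_sub U hleave hirr htrans a₂ a₁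
  obtain ⟨R, hR, haR⟩ := ((hlim.eventually (Metric.ball_mem_nhds 0 hε)).and ha).exists
  rw [← haR.1, ← haR.2, green_shift, green_shift, Real.dist_0_eq_abs] at hR
  exact (hge R).not_gt hR

end Decay

end WeightedGraph

end PeriodicWalk

theorem proposition5p4 {F : Type*} [Finite F] (G : PeriodicWalk.WeightedGraph F)
    (hirr : G.Irreducible) (htrans : G.Transient) : G.ConditionStar := by
  intro Λ hΛ
  refine ⟨fun N a v => ne_top_of_le_ne_top (G.green_ne_top htrans a v)
    (G.expectedVisits_le_green (Λ N) a v),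
    fun v₁ v₂ v => (G.green v₂ v).toReal - (G.green v₁ v).toReal, fun v₁ v₂ v _ => ?_,
    fun ε hε => G.exists_green_sub_lt hirr htrans hε⟩
  have hlim (a : PeriodicWalk.Vertex F) :=
    (ENNReal.tendsto_toReal (G.green_ne_top htrans a v)).comp
      (G.tendsto_expectedVisits hΛ a v (G.green_ne_top htrans a v))
  exact (hlim v₂).sub (hlim v₁)
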